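/- Throughout, $\Gamma$ is the rose with $r$ petals and edges indexed by $1,\dots,r$; its directions are the $2r$ oriented edges $d$, and $\overline d$ is $d$ with reversed orientation. Let $\phi\in Out(F_r)$ be fully irreducible and let $g:\Gamma\to\Gamma$ be a train track representative of $\phi$ (with respect to some marking) without periodic Nielsen paths; so $\phi$ is ageometric, and its ideal Whitehead graph $\mathcal{IW}(\phi)$ is the stable Whitehead graph $\mathcal{SW}(g)$. Here the local Whitehead graph $\mathcal{LW}(g)$ has the directions as vertices and an edge $[d_1,d_2]$ whenever the turn $\{d_1,d_2\}$ is traversed by some $g^m(e)$, $e$ an edge, and $\mathcal{SW}(g)$ is its restriction to the periodic directions. Suppose that $\mathcal{IW}(\phi)\cong\mathcal G$, where $\mathcal G$ is a connected simplicial graph with $2r-1$ vertices. Suppose that $g$ is ideally decomposed as $\Gamma=\Gamma_0\xrightarrow{g_1}\Gamma_1\to\cdots\xrightarrow{g_n}\Gamma_n=\Gamma$ (indices modulo $n$): each $\Gamma_s$ is an edge-indexed rose, each $g_s$ is a fold $u_s\mapsto a_su_s$ with $a_s\ne u_s,\overline{u_s}$ that sends every other edge to the edge with the same index, and $Dg$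 fixes every direction except possibly $u_n$. Let $G_s=G(f_s)$ be the lamination train track (ltt) structure of $f_s=g_s\circ\cdots\circ g_1\circ g_n\circ\cdots\circ g_{s+1}$: its colored edges are those of $\mathcal{LW}(f_s)$, its black edges are the pairs $[d,\overline d]$, periodic directions are purple, the others red, and a colored edge is purple if both its endpoints are purple and red otherwise. An ltt structure has type $(r;\frac32-r)$ if it has exactly $2r-1$ purple vertices, a unique red vertex $d^u$, a unique red edge $[d^u,\overline{d^a}]$ (which defines $d^a$), and a connected purple subgraph. A triple $(g_s,G_{s-1},G_s)$ is a generating triple if $G_{s-1},G_s$ have type $(r;\frac32-r)$, $d^u_s=u_s$, $d^a_s=a_s$, and the direction map $Dg_s$ induces a map from the colored edges of $G_{s-1}$ to those of $G_s$ that restricts to an isomorphism of the purple subgraphs. It is an extension if moreover $d^u_{s-1}=u_s$ (so purple vertices keep their labels), and a switch if moreover $d^u_{s-1}=a_s$ (so the purple vertex $u_s$ goes to $a_s$ and the other purple vertices keep their labels). Let $0\le k<n$. The composition $g'=g_n\circ\cdots\circ g_{k+1}$ is a construction composition if $(g_{k+1},G_k,G_{k+1})$ is a switch and $(g_s,G_{s-1},G_s)$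 is an extension for all $k+2\le s\le n$. Its construction path is $$[d^u_n,\overline{d^a_n},d^a_n,\overline{d^a_{n-1}},d^a_{n-1},\dots,\overline{d^a_{k+1}},d^a_{k+1}],$$ which starts with the red edge of $G_n$ and then alternates between the black edges $[\overline{d^a_s},d^a_s]$ and the edges $[d^a_s,\overline{d^a_{s-1}}]$, $k+2\le s\le n$; the latter are called its purple edges. **Lemma.** If $g'=g_n\circ\cdots\circ g_{k+1}$ is a construction composition, then $\mathcal G$ contains as a subgraph the purple edges of the construction path of $g'$: under any isomorphism $\mathcal{SW}(g)\cong\mathcal G$, for every $k+2\le s\le n$ the directions $d^a_s$ and $\overline{d^a_{s-1}}$ are periodic for $g$ and correspond to adjacent vertices of $\mathcal G$. -/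

import Mathlib

/-! ### Roses, edge maps and directions -/

/-- Oriented edges of the edge-indexed rose with `r` petals: `(i, true)` is the `i`-th edge and
`(i, false)` is the same edge with the opposite orientation.  Since a rose has a single vertex and an
oriented edge is determined by its initial direction, this is also the set of directions at the
vertex. -/
abbrev Dir (r : ℕ) : Type := Fin r × Bool

/-- Reversal of orientation. -/
def Dir.bar {r : ℕ} (d : Dir r) : Dir r := (d.1, !d.2)

/-- A self-map of the rose described by edge paths: the `i`-th edge is sent to a path of oriented
edges (no tightening is performed). -/
abbrev RoseMap (r : ℕ) : Type := Fin r → List (Dir r)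

namespace RoseMap

variable {r : ℕ}

/-- Image path of an oriented edge. -/
def onLetter (f : RoseMap r) (d : Dir r) : List (Dir r) :=
  if d.2 = true then f d.1 else FreeGroup.invRev (f d.1)

/-- Image path of an edge path. -/
def onWord (f : RoseMap r) (w : List (Dir r)) : List (Dir r) := w.flatMap f.onLetter

/-- The identity map. -/
def ident (r : ℕ) : RoseMap r := fun i => [(i, true)]

/-- The composition `f ∘ h` (first `h`, then `f`). -/
def comp (f h : RoseMap r) : RoseMap r := fun i => f.onWord (h i)

/-- The `m`-fold iterate of `f`. -/
def iter (f : RoseMap r) : ℕ → RoseMap r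
  | 0 => ident r
  | m + 1 => comp f (iter f m)

/-- The direction map: the initial edge of the image path.  (For maps sending edges to nonempty
paths the default value is never used.) -/
def dirMap (f : RoseMap r) (d : Dir r) : Dir r := (f.onLetter d).headD d

/-- The induced endomorphism of the fundamental group of the rose. -/
def toHom (f : RoseMap r) : FreeGroup (Fin r) →* FreeGroup (Fin r) :=
  FreeGroup.lift fun i => FreeGroup.mk (f i)

/-- The train track condition: edges are sent to nonempty paths, and no iterate of `f` produces
backtracking in the image of an edge. -/
def IsTrainTrack (f : RoseMap r) : Prop :=
  (∀ i, f i ≠ []) ∧ ∀ (m : ℕ) (i : Fin r), FreeGroup.IsReduced (f.iter m i)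

/-- Periodic directions. -/
def IsPeriodicDir (f : RoseMap r) (d : Dir r) : Prop := ∃ m, 0 < m ∧ f.dirMap^[m] d = d

/-- The local Whitehead graph at the vertex: directions `d₁ ≠ d₂` are joined by an edge when the turn
`{d₁, d₂}` is traversed by some `f ^ m (e)`, that is, when the path `f ^ m (e)` contains two
successive edges `d₁.bar, d₂` or `d₂.bar, d₁`. -/
def localWhiteheadGraph (f : RoseMap r) : SimpleGraph (Dir r) :=
  SimpleGraph.fromRel fun d₁ d₂ => ∃ (m : ℕ) (i : Fin r), [d₁.bar, d₂] <:+: f.iter m i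

/-- The local stable Whitehead graph: the restriction of the local Whitehead graph to the periodic
directions. -/
def stableWhiteheadGraph (f : RoseMap r) : SimpleGraph {d : Dir r | f.IsPeriodicDir d} :=
  f.localWhiteheadGraph.induce {d : Dir r | f.IsPeriodicDir d}

end RoseMap

/-! ### The rose as a topological space, topological representatives, Nielsen paths -/

/-- The gluing relation of the rose: all endpoints of the `r` unit intervals are identified with the
vertex. -/
inductive RoseRel (r : ℕ) : Unit ⊕ (Fin r × unitInterval) → Unit ⊕ (Fin r × unitInterval) → Prop
  | source (i : Fin r) : RoseRel r (Sum.inr (i, 0)) (Sum.inl ())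
  | target (i : Fin r) : RoseRel r (Sum.inr (i, 1)) (Sum.inl ())

/-- The rose with `r` petals. -/
abbrev Rose (r : ℕ) : Type := Quot (RoseRel r)

namespace Rose

variable {r : ℕ}

/-- The vertex. -/
def vertex (r : ℕ) : Rose r := Quot.mk _ (Sum.inl ())

/-- The path traversing the `i`-th petal. -/
def edgePath (i : Fin r) : Path (vertex r) (vertex r) where
  toFun t := Quot.mk _ (Sum.inr (i, t))
  continuous_toFun := continuous_quot_mk.comp (by fun_prop)
  source' := Quot.sound (RoseRel.source i)
  target' := Quot.sound (RoseRel.target i)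

/-- The path traversing an oriented edge. -/
def dirPath (d : Dir r) : Path (vertex r) (vertex r) :=
  if d.2 = true then edgePath d.1 else (edgePath d.1).symm

/-- The path traversing a list of oriented edges. -/
noncomputable def wordPath : List (Dir r) → Path (vertex r) (vertex r)
  | [] => Path.refl _
  | [d] => dirPath d
  | d :: e :: w => (dirPath d).trans (wordPath (e :: w))

end Rose

/-- The continuous map `γ` is a topological representative with underlying edge map `f`: it fixes the
vertex and maps each edge `i`, up to an increasing reparametrization, along the edge path `f i`. -/
def Realizes {r : ℕ} (γ : C(Rose r, Rose r)) (f : RoseMap r) : Prop :=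
  γ (Rose.vertex r) = Rose.vertex r ∧
  ∀ i : Fin r, ∃ θ : unitInterval ≃o unitInterval, ∀ t : unitInterval,
    γ (Rose.edgePath i t) = Rose.wordPath (f i) (θ t)

/-- A path is trivial if it is homotopic, relative to its endpoints, to a constant path. -/
def Path.IsTrivialPath {X : Type*} [TopologicalSpace X] {x y : X} (ρ : Path x y) : Prop :=
  ∃ h : y = x, Path.Homotopic ρ ((Path.refl x).cast rfl h)

/-- There is a periodic Nielsen path: a nontrivial path `ρ` with `γ ^ m (ρ) ≃ ρ` relative to the
endpoints for some `m > 0` (so that the endpoints are fixed by `γ ^ m`). -/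
def HasPeriodicNielsenPath {X : Type*} [TopologicalSpace X] (γ : C(X, X)) : Prop :=
  ∃ (m : ℕ) (_ : 0 < m) (x y : X) (hx : x = (γ^[m]) x) (hy : y = (γ^[m]) y) (ρ : Path x y),
    ¬ ρ.IsTrivialPath ∧
      Path.Homotopic ((ρ.map (γ.continuous.iterate m)).cast hx hy) ρ

/-! ### Outer automorphisms -/

instance innerNormal (F : Type*) [Group F] : (MulAut.conj (G := F)).range.Normal where
  conj_mem := by
    rintro _ ⟨x, rfl⟩ a
    refine ⟨a x, ?_⟩
    ext y
    simp [MulAut.conj_apply, MulAut.mul_apply]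

/-- The outer automorphism group. -/
abbrev OuterAut (F : Type*) [Group F] : Type _ := MulAut F ⧸ (MulAut.conj (G := F)).range

/-- `A` is a free factor of `F`: `F` is the internal free product of `A` and some subgroup. -/
def IsFreeFactor {F : Type*} [Group F] (A : Subgroup F) : Prop :=
  ∃ B : Subgroup F, Function.Bijective (Monoid.Coprod.lift A.subtype B.subtype)

/-- `φ` is fully irreducible: no positive power of `φ` preserves the conjugacy class of a proper
nontrivial free factor, that is, no automorphism in the class of a positive power preserves such a
factor. -/
def IsFullyIrreducible {F : Type*} [Group F] (φ : OuterAut F) : Prop :=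
  ∀ m : ℕ, 0 < m → ∀ Φ : MulAut F, (QuotientGroup.mk Φ : OuterAut F) = φ ^ m →
    ∀ A : Subgroup F, IsFreeFactor A → A ≠ ⊥ → A ≠ ⊤ → A.map Φ.toMonoidHom ≠ A

/-- The edge map `f` on the rose represents `φ`, with respect to some marking `μ`, which identifies
the free group with the fundamental group of the rose. -/
def RepresentsOuter {r : ℕ} (f : RoseMap r) (φ : OuterAut (FreeGroup (Fin r))) : Prop :=
  ∃ (μ : FreeGroup (Fin r) ≃* FreeGroup (Fin r)) (Φ : MulAut (FreeGroup (Fin r))),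
    (QuotientGroup.mk Φ : OuterAut (FreeGroup (Fin r))) = φ ∧ ∀ x, μ (Φ x) = f.toHom (μ x)

/-! ### Ideal decompositions -/

/-- A proper full fold of edge-indexed roses: `u ↦ a u`, all other edges (up to orientation) are
sent to the edges with the same index; here `a ≠ u, u.bar`.  So for the `k`-th fold of a
decomposition `u` is both `e^pu_{k-1}` and `e^u_k`, while `a` is `e^a_k` (and `e^pa_{k-1}`). -/
structure RoseFold (r : ℕ) where
  a : Dir r
  u : Dir r
  ne : a ≠ u
  ne_bar : a ≠ u.bar

/-- The edge map of a fold. -/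
def RoseFold.toMap {r : ℕ} (g : RoseFold r) : RoseMap r := fun i =>
  if (i, true) = g.u then [g.a, g.u]
  else if (i, true) = g.u.bar then [g.u.bar, g.a.bar]
  else [(i, true)]

/-- `foldComp g k m = g_{k+m} ∘ ⋯ ∘ g_{k+1}`. -/
def foldComp {r : ℕ} (g : ℕ → RoseFold r) (k : ℕ) : ℕ → RoseMap r
  | 0 => RoseMap.ident r
  | m + 1 => RoseMap.comp (g (k + m + 1)).toMap (foldComp g k m)

/-- An ideal decomposition `f = g_n ∘ ⋯ ∘ g_1` into folds of edge-indexed roses.  The indices are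
read cyclically modulo `n`, and `f` fixes every direction other than the one labelled by
`e^u_n`. -/
structure IdealDecomposition {r : ℕ} (f : RoseMap r) where
  n : ℕ
  n_pos : 0 < n
  g : ℕ → RoseFold r
  periodic : ∀ s, g (s + n) = g s
  eq_comp : f = foldComp g 0 n
  fixed : ∀ d : Dir r, d ≠ (g n).u → f.dirMap d = d

/-! ### Lamination train track structures -/

/-- A pair-labelled lamination train track (ltt) structure based at the rose with `r` petals.  The
vertices are the directions, the black edges are the pairs `{d, d.bar}`, one for each petal, and the
red and purple edges form the simple graph `colored`.  A vertex is purple or red, and a colored edge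
is purple exactly if both endpoints are. -/
structure LTT (r : ℕ) where
  colored : SimpleGraph (Dir r)
  purple : Set (Dir r)

namespace LTT

variable {r : ℕ}

/-- The purple subgraph. -/
def PI (G : LTT r) : SimpleGraph G.purple := G.colored.induce G.purple

/-- The red edges. -/
def redEdges (G : LTT r) : Set (Sym2 (Dir r)) :=
  {e | e ∈ G.colored.edgeSet ∧ ∃ d ∈ e, d ∉ G.purple}

/-- `(r; 3/2 - r)` ltt structures: `2r - 1` purple vertices, a unique red vertex, a unique red edge,
and a connected purple subgraph. -/
structure IsType (G : LTT r) : Prop where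
  card_purple : G.purple.ncard + 1 = 2 * r
  unique_red_vertex : ∃! d, d ∉ G.purple
  unique_red_edge : ∃! e, e ∈ G.redEdges
  connected : G.PI.Connected

/-- `d` is the unachieved direction `d^u`: the red vertex. -/
def IsUnachieved (G : LTT r) (d : Dir r) : Prop := d ∉ G.purple

/-- `d` is the twice-achieved direction `d^a`: the red edge is `[d^u, d.bar]`. -/
def IsTwiceAchieved (G : LTT r) (d : Dir r) : Prop :=
  ∃ u, G.IsUnachieved u ∧ G.colored.Adj u d.bar

end LTT

/-- The ltt structure `G(f)`: the local Whitehead graph with the periodic directions purple and the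
others red, together with the black edges. -/
def RoseMap.ltt {r : ℕ} (f : RoseMap r) : LTT r where
  colored := f.localWhiteheadGraph
  purple := {d | f.IsPeriodicDir d}

/-- Generating triples `(g, G, G')`. The induced map of ltt structures is the direction map on
vertices, extended over the colored edges; it has to exist and to restrict to an isomorphism of
the purple subgraphs. -/
structure IsGeneratingTriple {r : ℕ} (g : RoseFold r) (G G' : LTT r) : Prop where
  unachieved : G'.IsUnachieved g.u
  twiceAchieved : G'.IsTwiceAchieved g.a
  type_source : G.IsType
  type_dest : G'.IsType
  map_colored : ∀ x y, G.colored.Adj x y →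
    G'.colored.Adj (g.toMap.dirMap x) (g.toMap.dirMap y)
  bijOn_purple : Set.BijOn g.toMap.dirMap G.purple G'.purple
  purple_iff : ∀ x ∈ G.purple, ∀ y ∈ G.purple,
    (G'.colored.Adj (g.toMap.dirMap x) (g.toMap.dirMap y) ↔ G.colored.Adj x y)

/-- `(g, G, G')` is the extension determined by `[d^a, l]`, where `d^a` is the twice-achieved direction
of `G'`: the induced map preserves the labels of the purple vertices, the unachieved direction of
`G` is `e^pu`, and `l = (d^a).bar` for the twice-achieved direction of `G`.  (The pair `[d^a, l]` is
the image of the red edge of `G`, hence automatically a purple edge of `G'`.) -/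
structure IsExtensionBy {r : ℕ} (g : RoseFold r) (G G' : LTT r) (l : Dir r) : Prop where
  triple : IsGeneratingTriple g G G'
  extI : ∀ d ∈ G.purple, g.toMap.dirMap d = d
  extII : G.IsUnachieved g.u
  extIII : G.IsTwiceAchieved l.bar

/-- `(g, G, G')` is the switch determined by `[d^a, l]`, where `d^a` is the twice-achieved direction
of `G'`: the induced map sends `e^pu` to `d^a` and preserves the labels of the other purple vertices,
the unachieved direction of `G` is `e^pa`, and `l = (d^a).bar` for the twice-achieved direction of
`G`.  (Again `[d^a, l]` is automatically a purple edge of `G'`.) -/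
structure IsSwitchBy {r : ℕ} (g : RoseFold r) (G G' : LTT r) (l : Dir r) : Prop where
  triple : IsGeneratingTriple g G G'
  swI_mem : g.u ∈ G.purple
  swI : g.toMap.dirMap g.u = g.a
  swI_ne : ∀ d ∈ G.purple, d ≠ g.u → g.toMap.dirMap d = d
  swII : G.IsUnachieved g.a
  swIII : G.IsTwiceAchieved l.bar

/-- `(g_{k+1}, …, g_n; G_k, …, G_n)` is a construction composition: a switch followed by
extensions. -/
structure IsConstructionComposition {r : ℕ} (g : ℕ → RoseFold r) (G : ℕ → LTT r) (k n : ℕ) :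
    Prop where
  lt : k < n
  switch : ∃ l, IsSwitchBy (g (k + 1)) (G k) (G (k + 1)) l
  extension : ∀ s, k + 1 ≤ s → s < n → ∃ l, IsExtensionBy (g (s + 1)) (G s) (G (s + 1)) l

/-- The ltt structures `G_k = G(f_k)` of an ideal decomposition, for
`f_k = g_k ∘ ⋯ ∘ g_1 ∘ g_n ∘ ⋯ ∘ g_{k+1} = g_{k+n} ∘ ⋯ ∘ g_{k+1}`. -/
def IdealDecomposition.lttSeq {r : ℕ} {f : RoseMap r} (D : IdealDecomposition f) (k : ℕ) : LTT r :=
  (foldComp D.g k D.n).ltt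

/-- The construction path
`[d^u_n, (d^a_n).bar, d^a_n, (d^a_{n-1}).bar, d^a_{n-1}, …, (d^a_{k+1}).bar, d^a_{k+1}]` of a construction
composition `(g_{k+1}, …, g_n; G_k, …, G_n)`, as the list of its successive vertices. -/
def constructionPath {r : ℕ} (g : ℕ → RoseFold r) (k n : ℕ) : List (Dir r) :=
  (g n).u :: (List.range' (k + 1) (n - k)).reverse.flatMap fun s => [(g s).a.bar, (g s).a]

/-- The edges number 1, 3, 5, … of a path given by its list of vertices.  For a smooth path that
starts with a colored edge these are its colored edges. -/
def alternateEdges {α : Type*} : List α → List (Sym2 α)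
  | x :: y :: l => s(x, y) :: alternateEdges l
  | _ => []

/-- The purple edges `[d^a_s, (d^a_{s-1}).bar]` of the construction path: its colored edges except for
the first one, which is the red edge. -/
def constructionPurpleEdges {r : ℕ} (g : ℕ → RoseFold r) (k n : ℕ) : List (Sym2 (Dir r)) :=
  (alternateEdges (constructionPath g k n)).tail

/-! ### Representatives of type `(r; 3/2 - r)` -/

/-- `𝒢` belongs to `PI_(r; 3/2 - r)`: a connected simplicial graph with `2r - 1` vertices. -/
def IsPIGraph {V : Type*} (r : ℕ) (𝒢 : SimpleGraph V) : Prop :=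
  𝒢.Connected ∧ Nat.card V + 1 = 2 * r

/-- The map `γ` of the rose, with edge map `f`, is a train track representative without periodic
Nielsen paths of the fully irreducible outer automorphism `φ`.  As `γ` itself has no periodic Nielsen
paths, `φ` is ageometric, and its ideal Whitehead graph is the stable Whitehead graph of `γ` at the
vertex. -/
structure IsAFIRepresentative {r : ℕ} (φ : OuterAut (FreeGroup (Fin r)))
    (γ : C(Rose r, Rose r)) (f : RoseMap r) : Prop where
  fullyIrreducible : IsFullyIrreducible φ
  realizes : Realizes γ f
  represents : RepresentsOuter f φ
  trainTrack : f.IsTrainTrack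
  noPNP : ¬ HasPeriodicNielsenPath γ

/-! Each purple edge of the construction path is born as the image of a red edge. In an extension
`g_s` the red edge `[d^u_{s-1}, (d^a_{s-1}).bar]` of `G_{s-1}` starts at `u_s`, which the direction
map sends to `a_s`, while the other endpoint is fixed; so `[a_s, (a_{s-1}).bar]` is a colored edge
of `G_s` (`IsExtensionBy.adj_a_bar`). All folds of the composition share one unachieved direction
`u` (`u_succ`), and neither endpoint is `u`. The later extensions fix every direction except `u`, so
the edge survives into `G_n` (`adj_last`). Finally `G_n = G(f)` by cyclicity of the indices, and
there every direction but `u` is periodic, so the edge lies in the stable Whitehead graph. The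
switch enters only through its target `G_{k+1}`. -/

theorem Dir.bar_bar {r : ℕ} (d : Dir r) : d.bar.bar = d := by
  simp [Dir.bar]

theorem RoseFold.bar_a_ne_u {r : ℕ} (g : RoseFold r) : g.a.bar ≠ g.u := fun h =>
  g.ne_bar (by rw [← h, Dir.bar_bar])

/-- The direction map of a fold `u ↦ a u` sends `u` to `a`. -/
theorem RoseFold.dirMap_u {r : ℕ} (g : RoseFold r) : g.toMap.dirMap g.u = g.a := by
  obtain ⟨a, ⟨i, b⟩, h₁, h₂⟩ := g
  cases b <;>
    simp [RoseMap.dirMap, RoseMap.onLetter, RoseFold.toMap, Dir.bar, FreeGroup.invRev]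

/-- The direction map of a fold `u ↦ a u` fixes all directions other than `u`. -/
theorem RoseFold.dirMap_of_ne {r : ℕ} (g : RoseFold r) {d : Dir r} (hd : d ≠ g.u) :
    g.toMap.dirMap d = d := by
  obtain ⟨a, ⟨i, b⟩, h₁, h₂⟩ := g
  obtain ⟨j, c⟩ := d
  by_cases hij : j = i
  · subst hij
    -- On the petal of `u` only `u.bar` is left, and its image `u.bar a.bar` still begins with
    -- `u.bar`.
    cases b <;> cases c <;>
      simp_all [RoseMap.dirMap, RoseMap.onLetter, RoseFold.toMap, Dir.bar, FreeGroup.invRev]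
  · cases b <;> cases c <;>
      simp_all [RoseMap.dirMap, RoseMap.onLetter, RoseFold.toMap, Dir.bar, FreeGroup.invRev]

namespace LTT

variable {r : ℕ} {G : LTT r}

theorem IsType.unachieved_unique (hG : G.IsType) {d e : Dir r} (hd : G.IsUnachieved d)
    (he : G.IsUnachieved e) : d = e :=
  hG.unique_red_vertex.unique hd he

theorem IsType.mem_purple_of_ne (hG : G.IsType) {u d : Dir r} (hu : G.IsUnachieved u)
    (hd : d ≠ u) : d ∈ G.purple := by
  by_contra h
  exact hd (hG.unachieved_unique h hu)

/-- The red edge is `[d^u, d^a.bar]`. -/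
theorem IsType.adj_bar (hG : G.IsType) {u a : Dir r} (hu : G.IsUnachieved u)
    (ha : G.IsTwiceAchieved a) : G.colored.Adj u a.bar := by
  obtain ⟨v, hv, h⟩ := ha
  rwa [hG.unachieved_unique hu hv]

end LTT

/-- An extension preserves adjacency of the directions other than the unachieved one. -/
theorem IsExtensionBy.adj {r : ℕ} {g : RoseFold r} {G G' : LTT r} {l : Dir r}
    (h : IsExtensionBy g G G' l) {x y : Dir r} (hx : x ≠ g.u) (hy : y ≠ g.u)
    (hxy : G.colored.Adj x y) : G'.colored.Adj x y := by
  simpa only [g.dirMap_of_ne hx, g.dirMap_of_ne hy] using h.triple.map_colored x y hxy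

/-- The purple edge `[d^a, l]` of an extension is the image of the red edge. -/
theorem IsExtensionBy.adj_a_bar {r : ℕ} {g : RoseFold r} {G G' : LTT r} {l a : Dir r}
    (h : IsExtensionBy g G G' l) (ha : G.IsTwiceAchieved a) (hau : a.bar ≠ g.u) :
    G'.colored.Adj g.a a.bar := by
  simpa only [g.dirMap_u, g.dirMap_of_ne hau] using
    h.triple.map_colored _ _ (h.triple.type_source.adj_bar h.extII ha)

/-! ### Transport of edges along a construction composition -/

namespace IsConstructionComposition

variable {r : ℕ} {g : ℕ → RoseFold r} {G : ℕ → LTT r} {k n : ℕ}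

theorem triple (h : IsConstructionComposition g G k n) {s : ℕ} (hs : k ≤ s) (hn : s < n) :
    IsGeneratingTriple (g (s + 1)) (G s) (G (s + 1)) := by
  obtain rfl | hs := hs.eq_or_lt
  · exact h.switch.choose_spec.triple
  · exact (h.extension s hs hn).choose_spec.triple

/-- The folds of a construction composition have the same unachieved direction. -/
theorem u_succ (h : IsConstructionComposition g G k n) {s : ℕ} (hs : k ≤ s) (hn : s + 1 < n) :
    (g (s + 1 + 1)).u = (g (s + 1)).u := by
  obtain ⟨l, hl⟩ := h.extension (s + 1) (by omega) hn
  -- Both directions are the unique red vertex of `G (s + 1)`: one as source of an extension, the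
  -- other as target of the preceding triple.
  exact hl.triple.type_source.unachieved_unique hl.extII
    (h.triple hs (by omega)).unachieved

/-- Edges of `G s` that avoid the unachieved direction persist in `G n`. -/
theorem adj_last (h : IsConstructionComposition g G k n) {s : ℕ} (hs : k ≤ s) (hn : s < n)
    {x y : Dir r} (hx : x ≠ (g (s + 1)).u) (hy : y ≠ (g (s + 1)).u)
    (hxy : (G (s + 1)).colored.Adj x y) :
    x ≠ (g n).u ∧ y ≠ (g n).u ∧ (G n).colored.Adj x y := by
  obtain ⟨m, rfl⟩ := Nat.exists_eq_add_of_lt hn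
  induction m generalizing s with
  | zero => exact ⟨hx, hy, hxy⟩
  | succ m ih =>
    have hu := h.u_succ hs (by omega)
    obtain ⟨l, hl⟩ := h.extension (s + 1) (by omega) (by omega)
    -- The avoided direction is the same for the next fold, so the hypotheses carry over to it.
    rw [← hu] at hx hy
    have e : s + (m + 1) + 1 = s + 1 + m + 1 := by omega
    rw [e] at h ⊢
    exact ih (s := s + 1) (by omega) hx hy (hl.adj hx hy hxy) h (by omega)

/-- The pairs `[d^a_{s+2}, d^a_{s+1}.bar]` are purple edges of `G n`. -/
theorem adj_a_bar (h : IsConstructionComposition g G k n) {s : ℕ} (hs : k ≤ s)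
    (hn : s + 1 < n) :
    (g (s + 2)).a ≠ (g n).u ∧ (g (s + 1)).a.bar ≠ (g n).u ∧
      (G n).colored.Adj (g (s + 2)).a (g (s + 1)).a.bar := by
  obtain ⟨l, hl⟩ := h.extension (s + 1) (by omega) hn
  -- As `u` does not change, this is the condition `a ≠ u.bar` of the previous fold.
  have hau : (g (s + 1)).a.bar ≠ (g (s + 1 + 1)).u := by
    rw [h.u_succ hs hn]
    exact (g (s + 1)).bar_a_ne_u
  exact h.adj_last (s := s + 1) (by omega) hn (g (s + 2)).ne hau
    (hl.adj_a_bar (h.triple hs (by omega)).twiceAchieved hau)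

end IsConstructionComposition

/-! ### Reading the purple edges off the construction path -/

/-- The starting vertex `x` is arbitrary because removing the first colored edge and the black edge
after it leaves a path of the same shape that starts at `a_{k+m}`. -/
theorem mem_alternateEdges_constructionPath {r : ℕ} (g : ℕ → RoseFold r) (k m : ℕ) (x : Dir r)
    {e : Sym2 (Dir r)}
    (he : e ∈ alternateEdges (x :: (List.range' (k + 1) m).reverse.flatMap
      fun s => [(g s).a.bar, (g s).a])) :
    (0 < m ∧ e = s(x, (g (k + m)).a.bar)) ∨
      ∃ s, k ≤ s ∧ s + 1 < k + m ∧ e = s((g (s + 2)).a, (g (s + 1)).a.bar) := by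
  induction m generalizing x with
  | zero => simp [alternateEdges] at he
  | succ m ih =>
    have hidx : k + 1 + 1 * m = k + (m + 1) := by omega
    rw [List.range'_concat, List.reverse_append, hidx] at he
    simp only [List.reverse_cons, List.reverse_nil, List.nil_append, List.cons_append,
      List.flatMap_cons, alternateEdges, List.mem_cons] at he
    obtain rfl | he := he
    · exact Or.inl ⟨m.succ_pos, rfl⟩
    · obtain ⟨hm, rfl⟩ | ⟨s, hs, hsm, rfl⟩ := ih _ he
      -- The first edge of the shortened path starts at `a_{k+j+2}`, so it is the pair with `s = k +
      -- j`.
      · obtain ⟨j, rfl⟩ := Nat.exists_eq_succ_of_ne_zero hm.ne'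
        exact Or.inr ⟨k + j, by omega, by omega, rfl⟩
      · exact Or.inr ⟨s, hs, by omega, rfl⟩

/-- The purple edges of the construction path are the pairs `[d^a_{s+2}, d^a_{s+1}.bar]`. -/
theorem mem_constructionPurpleEdges {r : ℕ} {g : ℕ → RoseFold r} {k n : ℕ} (hkn : k < n)
    {e : Sym2 (Dir r)} (he : e ∈ constructionPurpleEdges g k n) :
    ∃ s, k ≤ s ∧ s + 1 < n ∧ e = s((g (s + 2)).a, (g (s + 1)).a.bar) := by
  obtain ⟨m, rfl⟩ := Nat.exists_eq_add_of_lt hkn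
  have hidx : k + 1 + 1 * m = k + m + 1 := by omega
  have hlen : k + m + 1 - k = m + 1 := by omega
  rw [constructionPurpleEdges, constructionPath, hlen, List.range'_concat, List.reverse_append,
    hidx] at he
  -- The tail discards the red edge `[u_n, (a_n).bar]`, leaving a path that starts at `a_n`.
  simp only [List.reverse_cons, List.reverse_nil, List.nil_append, List.cons_append,
    List.flatMap_cons, alternateEdges, List.tail_cons] at he
  obtain ⟨hm, rfl⟩ | ⟨s, hs, hsm, rfl⟩ := mem_alternateEdges_constructionPath g k m _ he
  · obtain ⟨j, rfl⟩ := Nat.exists_eq_succ_of_ne_zero hm.ne'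
    exact ⟨k + j, by omega, by omega, rfl⟩
  · exact ⟨s, hs, by omega, rfl⟩

/-! ### Closing the cycle: the last ltt structure is that of `f` -/

theorem foldComp_congr {r : ℕ} {g : ℕ → RoseFold r} {n : ℕ} (hg : ∀ s, g (s + n) = g s)
    (m : ℕ) : foldComp g n m = foldComp g 0 m := by
  induction m with
  | zero => rfl
  | succ m ih =>
    have h : g (n + m + 1) = g (0 + m + 1) := by
      rw [← hg (0 + m + 1)]
      congr 1
      omega
    simp only [foldComp, ih, h]

theorem IdealDecomposition.lttSeq_n {r : ℕ} {f : RoseMap r} (D : IdealDecomposition f) :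
    D.lttSeq D.n = f.ltt := by
  rw [IdealDecomposition.lttSeq, foldComp_congr D.periodic, ← D.eq_comp]

theorem mainTheorem6 {r : ℕ} {V : Type*} (𝒢 : SimpleGraph V) (h𝒢 : IsPIGraph r 𝒢)
    (φ : OuterAut (FreeGroup (Fin r))) (γ : C(Rose r, Rose r)) (f : RoseMap r)
    (hγ : IsAFIRepresentative φ γ f) (ι : f.stableWhiteheadGraph ≃g 𝒢)
    (D : IdealDecomposition f) (k : ℕ)
    (hk : IsConstructionComposition D.g D.lttSeq k D.n) :
    ∀ x y : Dir r, s(x, y) ∈ constructionPurpleEdges D.g k D.n →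
      ∃ (hx : f.IsPeriodicDir x) (hy : f.IsPeriodicDir y), 𝒢.Adj (ι ⟨x, hx⟩) (ι ⟨y, hy⟩) := by
  intro x y hxy
  obtain ⟨s, hs, hsn, he⟩ := mem_constructionPurpleEdges hk.lt hxy
  obtain ⟨ha, hb, hadj⟩ := hk.adj_a_bar hs hsn
  -- The last triple, be it a switch or an extension, shows that `G_n` has `u_n` as its only red
  -- vertex.
  have hlast := hk.triple (s := D.n - 1) (by omega) (by omega)
  rw [Nat.sub_add_cancel D.n_pos] at hlast
  have hpurple : ∀ d, d ≠ (D.g D.n).u → f.IsPeriodicDir d := fun d hd => by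
    have h := hlast.type_dest.mem_purple_of_ne hlast.unachieved hd
    rwa [D.lttSeq_n] at h
  rw [D.lttSeq_n] at hadj
  have key : x ≠ (D.g D.n).u ∧ y ≠ (D.g D.n).u ∧ f.localWhiteheadGraph.Adj x y := by
    obtain ⟨rfl, rfl⟩ | ⟨rfl, rfl⟩ := Sym2.eq_iff.1 he
    · exact ⟨ha, hb, hadj⟩
    · exact ⟨hb, ha, hadj.symm⟩
  exact ⟨hpurple x key.1, hpurple y key.2.1, ι.map_rel_iff.2 key.2.2⟩
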